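/- All groups are discrete and countable (finite groups are allowed). For countable groups $\Lambda,\Gamma$ let $[\Lambda,\Gamma]=\{f:\Lambda\to\Gamma \mid f(e)=e\}$, a Polish space in the topology of pointwise convergence, on which $\Lambda$ acts by $(\lambda\cdot f)(x)=f(x\lambda)f(\lambda)^{-1}$ for $\lambda,x\in\Lambda$. Call $\Lambda$ a \emph{random subgroup} of $\Gamma$ if there is a $\Lambda$-invariant Borel probability measure on $[\Lambda,\Gamma]$ that is supported on the injective maps, i.e. for which almost every $f$ is injective. \textbf{Corollary.} Let $\Lambda_1,\Lambda_2,\Gamma_1,\Gamma_2$ be countable groups. If $\Lambda_i$ is a random subgroup of $\Gamma_i$ for $i=1,2$, then the free product $\Lambda_1*\Lambda_2$ is a random subgroup of the free product $\Gamma_1*\Gamma_2$. -/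

import Mathlib

open MeasureTheory

/-- The space `[Λ, Γ]` of all maps `f : Λ → Γ` with `f 1 = 1`. -/
def PointedMap (Λ Γ : Type*) [Group Λ] [Group Γ] : Type _ :=
  {f : Λ → Γ // f 1 = 1}

namespace PointedMap

instance instFunLike (Λ Γ : Type*) [Group Λ] [Group Γ] : FunLike (PointedMap Λ Γ) Λ Γ where
  coe f := f.1
  coe_injective := Subtype.val_injective

@[ext]
theorem ext {Λ Γ : Type*} [Group Λ] [Group Γ] {f g : PointedMap Λ Γ} (h : ∀ x, f x = g x) :
    f = g :=
  DFunLike.ext f g h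

@[simp]
theorem map_one' {Λ Γ : Type*} [Group Λ] [Group Γ] (f : PointedMap Λ Γ) : f 1 = 1 := f.2

/-- The topology of pointwise convergence, `Γ` being discrete. -/
instance instTopologicalSpace (Λ Γ : Type*) [Group Λ] [Group Γ] :
    TopologicalSpace (PointedMap Λ Γ) :=
  TopologicalSpace.induced (fun (f : PointedMap Λ Γ) (x : Λ) => f x)
    (@Pi.topologicalSpace Λ (fun _ => Γ) (fun _ => ⊥))

/-- For countable groups, `[Λ, Γ]` is a Polish space. -/
theorem polishSpace (Λ Γ : Type*) [Group Λ] [Group Γ] [Countable Λ] [Countable Γ] :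
    PolishSpace (PointedMap Λ Γ) := by
  let _ : TopologicalSpace Γ := ⊥
  have _ : DiscreteTopology Γ := ⟨rfl⟩
  have _ : SecondCountableTopology Γ := inferInstance
  have _ : PolishSpace Γ := ⟨⟩
  have hcl : IsClosed {f : Λ → Γ | f 1 = 1} :=
    isClosed_eq (continuous_apply 1) continuous_const
  exact hcl.polishSpace

/-- The Borel σ-algebra of `[Λ, Γ]`. -/
instance instMeasurableSpace (Λ Γ : Type*) [Group Λ] [Group Γ] :
    MeasurableSpace (PointedMap Λ Γ) :=
  borel (PointedMap Λ Γ)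

instance instBorelSpace (Λ Γ : Type*) [Group Λ] [Group Γ] : BorelSpace (PointedMap Λ Γ) := ⟨rfl⟩

/-- The left action of `Λ` on `[Λ, Γ]`: `(l • f) x = f (x * l) * (f l)⁻¹`. -/
instance instMulAction (Λ Γ : Type*) [Group Λ] [Group Γ] : MulAction Λ (PointedMap Λ Γ) where
  smul l f := ⟨fun x => f (x * l) * (f l)⁻¹, by simp⟩
  one_smul f := by
    apply Subtype.ext
    funext x
    change f (x * 1) * (f 1)⁻¹ = f x
    simp
  mul_smul l m f := by
    apply Subtype.ext
    funext x
    change f (x * (l * m)) * (f (l * m))⁻¹ =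
      (f (x * l * m) * (f m)⁻¹) * (f (l * m) * (f m)⁻¹)⁻¹
    simp [mul_assoc]

@[simp]
theorem smul_apply {Λ Γ : Type*} [Group Λ] [Group Γ] (l : Λ) (f : PointedMap Λ Γ) (x : Λ) :
    (l • f) x = f (x * l) * (f l)⁻¹ := rfl

end PointedMap

/-- A randomorphism from `Λ` to `Γ`: a `Λ`-invariant Borel probability measure on `[Λ, Γ]`. -/
structure IsRandomorphism {Λ Γ : Type*} [Group Λ] [Group Γ]
    (μ : Measure (PointedMap Λ Γ)) : Prop where
  isProbabilityMeasure : IsProbabilityMeasure μ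
  invariant : SMulInvariantMeasure Λ (PointedMap Λ Γ) μ

/-- A randembedding: a randomorphism supported on the injective maps. -/
structure IsRandembedding {Λ Γ : Type*} [Group Λ] [Group Γ]
    (μ : Measure (PointedMap Λ Γ)) : Prop extends IsRandomorphism μ where
  ae_injective : ∀ᵐ f : PointedMap Λ Γ ∂μ, Function.Injective f

/-- `Λ` is a random subgroup of `Γ` if it admits a randembedding into `Γ`. -/
def IsRandomSubgroup (Λ Γ : Type*) [Group Λ] [Group Γ] : Prop :=
  ∃ μ : Measure (PointedMap Λ Γ), IsRandembedding μ

/-! ### Reduced words in a free product of two groups -/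

namespace Monoid.Coprod

section ReducedWords

variable {G H : Type*} [Group G] [Group H]

/-! The action on `[Λ, Γ]` is defined so that evaluation `(a, f) ↦ f a` is a cocycle: `f (a * b) =
(b • f) a * f b`. Let each `Λᵢ` act on its own coordinate of `[Λ₁, Γ₁] × [Λ₂, Γ₂]`. By the universal
property the two actions and their cocycles extend to `Λ₁ * Λ₂`, with values in `Γ₁ * Γ₂`. Sending a
point `x` to `l ↦ coprodCocycle l x` is equivariant (`smul_coprod`), so it pushes the invariant
measure `μ.prod ν` to an invariant one. If both coordinates of `x` are injective, the cocycle turns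
a reduced word into a reduced word with the same sequence of factors. A nonempty reduced word is
never trivial (`wordProd_ne_one`), and this makes the image map injective (`injective_coprod`). -/

instance instCountable [Countable G] [Countable H] : Countable (Monoid.Coprod G H) := by
  have : Countable (FreeMonoid (G ⊕ H)) := inferInstanceAs (Countable (List (G ⊕ H)))
  exact (Monoid.Coprod.mk_surjective (M := G) (N := H)).countable

/-- The element of the free product represented by a letter. -/
def ofLetter : G ⊕ H → Monoid.Coprod G H
  | .inl a => Monoid.Coprod.inl a
  | .inr b => Monoid.Coprod.inr b

/-- A letter is nontrivial if it is not the identity of its factor. -/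
def LetterNeOne : G ⊕ H → Prop
  | .inl a => a ≠ 1
  | .inr b => b ≠ 1

/-- The element of the free product represented by a word. -/
def wordProd (l : List (G ⊕ H)) : Monoid.Coprod G H := (l.map ofLetter).prod

/-- Reduced words: nontrivial letters, coming alternatingly from the two factors. -/
def IsReduced (l : List (G ⊕ H)) : Prop :=
  (∀ a ∈ l, LetterNeOne a) ∧ (l.map Sum.isLeft).IsChain (· ≠ ·)

@[simp]
theorem wordProd_nil : wordProd ([] : List (G ⊕ H)) = 1 := rfl

@[simp]
theorem wordProd_cons (a : G ⊕ H) (l : List (G ⊕ H)) :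
    wordProd (a :: l) = ofLetter a * wordProd l := by
  simp [wordProd]

theorem IsReduced.tail {a : G ⊕ H} {l : List (G ⊕ H)} (h : IsReduced (a :: l)) :
    IsReduced l := by
  refine ⟨fun b hb => h.1 b (List.mem_cons_of_mem _ hb), ?_⟩
  have := h.2
  rw [List.map_cons] at this
  exact this.tail

/-- A trivial letter is dropped, a letter from the other factor is prepended, and one from the same
factor merges with the head. If the merged letter is trivial, the tail is already reduced. -/
theorem exists_isReduced_ofLetter_mul (c : G ⊕ H) {l : List (G ⊕ H)} (hl : IsReduced l) :
    ∃ l', IsReduced l' ∧ wordProd l' = ofLetter c * wordProd l := by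
  by_cases hc : LetterNeOne c
  swap
  · refine ⟨l, hl, ?_⟩
    rcases c with a | b <;> simp_all [LetterNeOne, ofLetter]
  rcases l with _ | ⟨d, t⟩
  · exact ⟨[c], ⟨by simpa using hc, by simp⟩, by simp⟩
  by_cases hcd : c.isLeft = d.isLeft
  · have key : ∃ e : G ⊕ H, e.isLeft = d.isLeft ∧ ofLetter e = ofLetter c * ofLetter d ∧
        (¬ LetterNeOne e → ofLetter e = 1) := by
      rcases c with a | a <;> rcases d with b | b <;> simp at hcd
      · exact ⟨.inl (a * b), rfl, by simp [ofLetter], by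
          simp only [LetterNeOne, ofLetter, not_not]; intro h; simp [h]⟩
      · exact ⟨.inr (a * b), rfl, by simp [ofLetter], by
          simp only [LetterNeOne, ofLetter, not_not]; intro h; simp [h]⟩
    obtain ⟨e, he, hmul, hone⟩ := key
    by_cases hne : LetterNeOne e
    · refine ⟨e :: t, ⟨?_, ?_⟩, by simp [hmul, mul_assoc]⟩
      · rintro x hx
        rcases List.mem_cons.1 hx with rfl | hx
        · exact hne
        · exact hl.tail.1 x hx
      -- The merged letter lies in the factor of the old head, so alternation is inherited.
      · simpa [he] using hl.2
    · exact ⟨t, hl.tail, by rw [wordProd_cons, ← mul_assoc, ← hmul, hone hne, one_mul]⟩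
  · refine ⟨c :: d :: t, ⟨?_, ?_⟩, by simp⟩
    · rintro x hx
      rcases List.mem_cons.1 hx with rfl | hx
      · exact hc
      · exact hl.1 x hx
    · have := hl.2
      simp only [List.map_cons, List.isChain_cons_cons] at this ⊢
      exact ⟨hcd, this⟩

theorem exists_isReduced_wordProd_eq (g : Monoid.Coprod G H) :
    ∃ l, IsReduced l ∧ wordProd l = g := by
  induction g using Monoid.Coprod.induction_on' with
  | one => exact ⟨[], ⟨by simp, by simp⟩, rfl⟩
  | inl_mul m x ih =>
    obtain ⟨l, hl, rfl⟩ := ih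
    exact exists_isReduced_ofLetter_mul (.inl m) hl
  | inr_mul n x ih =>
    obtain ⟨l, hl, rfl⟩ := ih
    exact exists_isReduced_ofLetter_mul (.inr n) hl

end ReducedWords

/-! ### Nontriviality of reduced words -/

section NormalForm

universe u v

variable (G : Type u) (H : Type v) [Group G] [Group H]

/-- The two factors as a family indexed by `Bool`. -/
def Factor : Bool → Type (max u v)
  | true => ULift.{v} G
  | false => ULift.{u} H

instance Factor.instGroup : ∀ b, Group (Factor G H b)
  | true => inferInstanceAs (Group (ULift.{v} G))
  | false => inferInstanceAs (Group (ULift.{u} H))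

variable {G H}

/-- A letter, as an element of the family of factors. -/
def letterToFactor : G ⊕ H → Σ b, Factor G H b
  | .inl a => ⟨true, ULift.up a⟩
  | .inr b => ⟨false, ULift.up b⟩

variable (G H) in
/-- The canonical map from the binary free product to the indexed one. -/
def toCoprodI : Monoid.Coprod G H →* Monoid.CoprodI (Factor G H) :=
  Monoid.Coprod.lift
    ((Monoid.CoprodI.of (M := Factor G H) (i := true)).comp
      (MulEquiv.ulift (α := G)).symm.toMonoidHom)
    ((Monoid.CoprodI.of (M := Factor G H) (i := false)).comp
      (MulEquiv.ulift (α := H)).symm.toMonoidHom)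

theorem toCoprodI_ofLetter (a : G ⊕ H) :
    toCoprodI G H (ofLetter a) = Monoid.CoprodI.of (letterToFactor a).2 := by
  cases a
  · exact Monoid.Coprod.lift_apply_inl _ _ _
  · exact Monoid.Coprod.lift_apply_inr _ _ _

/-- Transported to the indexed free product, `l` becomes a word in normal form, and normal forms are
unique there. -/
theorem wordProd_ne_one {l : List (G ⊕ H)} (hl : IsReduced l) (hne : l ≠ []) :
    wordProd l ≠ 1 := by
  classical
  have hfst (a : G ⊕ H) : (letterToFactor a).1 = a.isLeft := by
    cases a <;> rfl
  let w : Monoid.CoprodI.Word (Factor G H) :=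
    { toList := l.map letterToFactor
      ne_one := by
        intro p hp
        obtain ⟨a, ha, rfl⟩ := List.mem_map.1 hp
        have := hl.1 a ha
        rcases a with a | a
        · exact fun h => this (congrArg ULift.down h)
        · exact fun h => this (congrArg ULift.down h)
      chain_ne := by
        have := hl.2
        rw [List.isChain_map] at this ⊢
        simpa only [hfst] using this }
  have hw : toCoprodI G H (wordProd l) = w.prod := by
    simp only [wordProd, Monoid.CoprodI.Word.prod, w, map_list_prod, List.map_map]
    congr 1
    exact List.map_congr_left fun a _ => toCoprodI_ofLetter a
  intro h
  rw [h, map_one] at hw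
  have : w = Monoid.CoprodI.Word.empty := by
    rw [← Monoid.CoprodI.Word.prod_empty] at hw
    exact (Monoid.CoprodI.Word.equiv.symm.injective hw).symm
  have h' := congrArg Monoid.CoprodI.Word.toList this
  exact hne (List.map_eq_nil_iff.1 h')

end NormalForm

end Monoid.Coprod

/-! ### Measurability in `[Λ, Γ]` -/

namespace PointedMap

section Measurability

variable {Λ Γ : Type*} [Group Λ] [Group Γ]

/-- Countability makes the Borel σ-algebra of the product the product σ-algebra, so measurability
can be tested on evaluations. -/
theorem instMeasurableSpace_eq_comap [Countable Λ] [Countable Γ] :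
    instMeasurableSpace Λ Γ = MeasurableSpace.comap (fun (f : PointedMap Λ Γ) (x : Λ) => f x)
      (@MeasurableSpace.pi Λ (fun _ => Γ) (fun _ => ⊤)) := by
  let _ : TopologicalSpace Γ := ⊥
  have _ : DiscreteTopology Γ := ⟨rfl⟩
  let _ : MeasurableSpace Γ := ⊤
  have _ : BorelSpace Γ := ⟨borel_eq_top_of_discrete.symm⟩
  change @borel _ (TopologicalSpace.induced _ _) = _
  rw [borel_comap, ← BorelSpace.measurable_eq]

theorem measurable_eval [Countable Λ] [Countable Γ] (x : Λ) :
    @Measurable (PointedMap Λ Γ) Γ _ ⊤ (fun f => f x) := by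
  let _ : MeasurableSpace Γ := ⊤
  have h : Measurable[_, MeasurableSpace.pi] (fun (f : PointedMap Λ Γ) (x : Λ) => f x) := by
    rw [instMeasurableSpace_eq_comap]
    exact comap_measurable _
  exact (measurable_pi_apply x).comp h

theorem measurable_of_eval [Countable Λ] [Countable Γ] {X : Type*} [MeasurableSpace X]
    {F : X → PointedMap Λ Γ} (h : ∀ x, @Measurable X Γ _ ⊤ (fun p => F p x)) :
    Measurable F := by
  let _ : MeasurableSpace Γ := ⊤
  rw [instMeasurableSpace_eq_comap, measurable_comap_iff]
  exact measurable_pi_lambda _ h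

theorem measurable_smul [Countable Λ] [Countable Γ] (l : Λ) :
    Measurable (fun f : PointedMap Λ Γ => l • f) := by
  let _ : MeasurableSpace Γ := ⊤
  refine measurable_of_eval fun x => ?_
  have h : Measurable fun f : PointedMap Λ Γ => (f (x * l), f l) :=
    (measurable_eval _).prodMk (measurable_eval _)
  exact (measurable_of_countable fun p : Γ × Γ => p.1 * p.2⁻¹).comp h

theorem measurableSet_injective [Countable Λ] [Countable Γ] :
    MeasurableSet {f : PointedMap Λ Γ | Function.Injective f} := by
  let _ : MeasurableSpace Γ := ⊤
  have : {f : PointedMap Λ Γ | Function.Injective f} =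
      ⋂ x : Λ, ⋂ y : Λ, {f | f x = f y → x = y} := by
    ext f
    simp [Function.Injective]
  rw [this]
  refine MeasurableSet.iInter fun x => MeasurableSet.iInter fun y => ?_
  have h : Measurable fun f : PointedMap Λ Γ => (f x, f y) :=
    (measurable_eval _).prodMk (measurable_eval _)
  exact h (Set.to_countable {p : Γ × Γ | p.1 = p.2 → x = y}).measurableSet

theorem smul_injective {l : Λ} {f : PointedMap Λ Γ} (hf : Function.Injective f) :
    Function.Injective (l • f) := by
  intro x y h
  simpa using hf (mul_right_cancel h)

end Measurability

/-! ### The free product of two pointed maps -/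

section Coprod

open Monoid.Coprod

variable {Λ₁ Λ₂ Γ₁ Γ₂ : Type*} [Group Λ₁] [Group Λ₂] [Group Γ₁] [Group Γ₂]

variable (Λ₁ Λ₂ Γ₁ Γ₂) in
/-- The action of `Λ₁ * Λ₂` on `[Λ₁, Γ₁] × [Λ₂, Γ₂]` through its factors, extended to
`[Λ₁, Γ₁] × [Λ₂, Γ₂] × (Γ₁ * Γ₂)` by the cocycle given by evaluation. -/
def skewProduct : Monoid.Coprod Λ₁ Λ₂ →*
    Function.End ((PointedMap Λ₁ Γ₁ × PointedMap Λ₂ Γ₂) × Monoid.Coprod Γ₁ Γ₂) :=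
  Monoid.Coprod.lift
    { toFun := fun a p => ((a • p.1.1, p.1.2), inl (p.1.1 a) * p.2)
      map_one' := by
        funext p
        rw [Function.End.one_def]
        simp
      -- In the last coordinate this is the cocycle identity for evaluation.
      map_mul' := fun a b => by
        funext p
        change _ = ((a • b • p.1.1, p.1.2), inl ((b • p.1.1) a) * (inl (p.1.1 b) * p.2))
        rw [← mul_assoc, ← map_mul]
        simp [mul_smul] }
    { toFun := fun a p => ((p.1.1, a • p.1.2), inr (p.1.2 a) * p.2)
      map_one' := by
        funext p
        rw [Function.End.one_def]
        simp
      map_mul' := fun a b => by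
        funext p
        change _ = ((p.1.1, a • b • p.1.2), inr ((b • p.1.2) a) * (inr (p.1.2 b) * p.2))
        rw [← mul_assoc, ← map_mul]
        simp [mul_smul] }

/-- The action of `Λ₁ * Λ₂` on `[Λ₁, Γ₁] × [Λ₂, Γ₂]` through its factors. -/
def coprodAct (l : Monoid.Coprod Λ₁ Λ₂) (x : PointedMap Λ₁ Γ₁ × PointedMap Λ₂ Γ₂) :
    PointedMap Λ₁ Γ₁ × PointedMap Λ₂ Γ₂ :=
  (skewProduct Λ₁ Λ₂ Γ₁ Γ₂ l (x, 1)).1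

/-- The cocycle of the action `coprodAct` extending evaluation on the factors. -/
def coprodCocycle (l : Monoid.Coprod Λ₁ Λ₂) (x : PointedMap Λ₁ Γ₁ × PointedMap Λ₂ Γ₂) :
    Monoid.Coprod Γ₁ Γ₂ :=
  (skewProduct Λ₁ Λ₂ Γ₁ Γ₂ l (x, 1)).2

theorem skewProduct_inl (a : Λ₁)
    (p : (PointedMap Λ₁ Γ₁ × PointedMap Λ₂ Γ₂) × Monoid.Coprod Γ₁ Γ₂) :
    skewProduct Λ₁ Λ₂ Γ₁ Γ₂ (inl a) p = ((a • p.1.1, p.1.2), inl (p.1.1 a) * p.2) := rfl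

theorem skewProduct_inr (a : Λ₂)
    (p : (PointedMap Λ₁ Γ₁ × PointedMap Λ₂ Γ₂) × Monoid.Coprod Γ₁ Γ₂) :
    skewProduct Λ₁ Λ₂ Γ₁ Γ₂ (inr a) p = ((p.1.1, a • p.1.2), inr (p.1.2 a) * p.2) := rfl

theorem skewProduct_mul (l m : Monoid.Coprod Λ₁ Λ₂)
    (p : (PointedMap Λ₁ Γ₁ × PointedMap Λ₂ Γ₂) × Monoid.Coprod Γ₁ Γ₂) :
    skewProduct Λ₁ Λ₂ Γ₁ Γ₂ (l * m) p =
      skewProduct Λ₁ Λ₂ Γ₁ Γ₂ l (skewProduct Λ₁ Λ₂ Γ₁ Γ₂ m p) := by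
  rw [map_mul]
  rfl

theorem skewProduct_one (p : (PointedMap Λ₁ Γ₁ × PointedMap Λ₂ Γ₂) × Monoid.Coprod Γ₁ Γ₂) :
    skewProduct Λ₁ Λ₂ Γ₁ Γ₂ 1 p = p := by
  rw [map_one]
  rfl

/-- Generators act on the last coordinate by left multiplication, which commutes with right
multiplication; hence the values at `1` determine everything. -/
theorem skewProduct_apply_mul (l : Monoid.Coprod Λ₁ Λ₂)
    (x : PointedMap Λ₁ Γ₁ × PointedMap Λ₂ Γ₂) (g h : Monoid.Coprod Γ₁ Γ₂) :
    skewProduct Λ₁ Λ₂ Γ₁ Γ₂ l (x, g * h) =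
      ((skewProduct Λ₁ Λ₂ Γ₁ Γ₂ l (x, g)).1, (skewProduct Λ₁ Λ₂ Γ₁ Γ₂ l (x, g)).2 * h) := by
  induction l using Monoid.Coprod.induction_on' with
  | one => simp [skewProduct_one]
  | inl_mul m y ih => simp only [skewProduct_mul, ih, skewProduct_inl, mul_assoc]
  | inr_mul m y ih => simp only [skewProduct_mul, ih, skewProduct_inr, mul_assoc]

theorem skewProduct_apply (l : Monoid.Coprod Λ₁ Λ₂)
    (x : PointedMap Λ₁ Γ₁ × PointedMap Λ₂ Γ₂) (g : Monoid.Coprod Γ₁ Γ₂) :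
    skewProduct Λ₁ Λ₂ Γ₁ Γ₂ l (x, g) = (coprodAct l x, coprodCocycle l x * g) := by
  simpa [coprodAct, coprodCocycle] using skewProduct_apply_mul l x 1 g

theorem coprodAct_mul (l m : Monoid.Coprod Λ₁ Λ₂) (x : PointedMap Λ₁ Γ₁ × PointedMap Λ₂ Γ₂) :
    coprodAct (l * m) x = coprodAct l (coprodAct m x) := by
  have h := skewProduct_mul l m (x, 1)
  rw [skewProduct_apply m x 1, skewProduct_apply, skewProduct_apply] at h
  exact (Prod.mk.inj h).1

theorem coprodCocycle_mul (l m : Monoid.Coprod Λ₁ Λ₂)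
    (x : PointedMap Λ₁ Γ₁ × PointedMap Λ₂ Γ₂) :
    coprodCocycle (l * m) x = coprodCocycle l (coprodAct m x) * coprodCocycle m x := by
  have h := skewProduct_mul l m (x, 1)
  rw [skewProduct_apply m x 1, skewProduct_apply, skewProduct_apply] at h
  simpa using congrArg Prod.snd h

@[simp]
theorem coprodAct_one (x : PointedMap Λ₁ Γ₁ × PointedMap Λ₂ Γ₂) :
    coprodAct (1 : Monoid.Coprod Λ₁ Λ₂) x = x := by
  rw [coprodAct, skewProduct_one]

@[simp]
theorem coprodCocycle_one (x : PointedMap Λ₁ Γ₁ × PointedMap Λ₂ Γ₂) :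
    coprodCocycle (1 : Monoid.Coprod Λ₁ Λ₂) x = 1 := by
  rw [coprodCocycle, skewProduct_one]

theorem coprodAct_inl (a : Λ₁) (x : PointedMap Λ₁ Γ₁ × PointedMap Λ₂ Γ₂) :
    coprodAct (inl a) x = (a • x.1, x.2) := rfl

theorem coprodAct_inr (a : Λ₂) (x : PointedMap Λ₁ Γ₁ × PointedMap Λ₂ Γ₂) :
    coprodAct (inr a) x = (x.1, a • x.2) := rfl

theorem coprodCocycle_inl (a : Λ₁) (x : PointedMap Λ₁ Γ₁ × PointedMap Λ₂ Γ₂) :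
    coprodCocycle (inl a) x = inl (x.1 a) :=
  mul_one _

theorem coprodCocycle_inr (a : Λ₂) (x : PointedMap Λ₁ Γ₁ × PointedMap Λ₂ Γ₂) :
    coprodCocycle (inr a) x = inr (x.2 a) :=
  mul_one _

/-- The free product of two pointed maps: the orbit map of the cocycle `coprodCocycle`. -/
def coprod (x : PointedMap Λ₁ Γ₁ × PointedMap Λ₂ Γ₂) :
    PointedMap (Monoid.Coprod Λ₁ Λ₂) (Monoid.Coprod Γ₁ Γ₂) :=
  ⟨fun l => coprodCocycle l x, coprodCocycle_one x⟩

theorem coprod_apply (x : PointedMap Λ₁ Γ₁ × PointedMap Λ₂ Γ₂) (l : Monoid.Coprod Λ₁ Λ₂) :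
    coprod x l = coprodCocycle l x := rfl

theorem smul_coprod (l : Monoid.Coprod Λ₁ Λ₂) (x : PointedMap Λ₁ Γ₁ × PointedMap Λ₂ Γ₂) :
    l • coprod x = coprod (coprodAct l x) := by
  ext y
  rw [smul_apply, coprod_apply, coprod_apply, coprod_apply, coprodCocycle_mul,
    mul_inv_cancel_right]

/-! ### Injectivity of the free product map -/

theorem injective_coprodAct (l : Monoid.Coprod Λ₁ Λ₂)
    {x : PointedMap Λ₁ Γ₁ × PointedMap Λ₂ Γ₂}
    (hx : Function.Injective x.1 ∧ Function.Injective x.2) :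
    Function.Injective (coprodAct l x).1 ∧ Function.Injective (coprodAct l x).2 := by
  induction l using Monoid.Coprod.induction_on' with
  | one => simpa using hx
  | inl_mul m y ih =>
    rw [coprodAct_mul, coprodAct_inl]
    exact ⟨smul_injective ih.1, ih.2⟩
  | inr_mul m y ih =>
    rw [coprodAct_mul, coprodAct_inr]
    exact ⟨ih.1, smul_injective ih.2⟩

/-- For injective maps the cocycle sends words to words of the same type,
with nontrivial letters going to nontrivial letters. -/
theorem exists_coprodCocycle_wordProd_eq {x : PointedMap Λ₁ Γ₁ × PointedMap Λ₂ Γ₂}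
    (hx : Function.Injective x.1 ∧ Function.Injective x.2) (l : List (Λ₁ ⊕ Λ₂))
    (hl : ∀ a ∈ l, LetterNeOne a) :
    ∃ l' : List (Γ₁ ⊕ Γ₂), (∀ a ∈ l', LetterNeOne a) ∧
      l'.map Sum.isLeft = l.map Sum.isLeft ∧ coprodCocycle (wordProd l) x = wordProd l' := by
  induction l with
  | nil => exact ⟨[], by simp, rfl, by simp⟩
  | cons c t ih =>
    obtain ⟨t', ht', hmap, heq⟩ := ih fun a ha => hl a (List.mem_cons_of_mem _ ha)
    have hy := injective_coprodAct (wordProd t) hx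
    have hc := hl c List.mem_cons_self
    rw [wordProd_cons, coprodCocycle_mul, heq]
    rcases c with a | a
    · refine ⟨.inl ((coprodAct (wordProd t) x).1 a) :: t', ?_, by simp [hmap], ?_⟩
      · rintro b hb
        rcases List.mem_cons.1 hb with rfl | hb
        -- Injectivity and `f 1 = 1` keep a nontrivial letter nontrivial, here at the translated
        -- point where the cocycle evaluates it.
        · exact fun h => hc (hy.1 (h.trans (map_one' _).symm))
        · exact ht' b hb
      · rw [wordProd_cons]
        exact congrArg (· * _) (coprodCocycle_inl _ _)
    · refine ⟨.inr ((coprodAct (wordProd t) x).2 a) :: t', ?_, by simp [hmap], ?_⟩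
      · rintro b hb
        rcases List.mem_cons.1 hb with rfl | hb
        · exact fun h => hc (hy.2 (h.trans (map_one' _).symm))
        · exact ht' b hb
      · rw [wordProd_cons]
        exact congrArg (· * _) (coprodCocycle_inr _ _)

theorem eq_one_of_coprodCocycle_eq_one {x : PointedMap Λ₁ Γ₁ × PointedMap Λ₂ Γ₂}
    (hx : Function.Injective x.1 ∧ Function.Injective x.2) {l : Monoid.Coprod Λ₁ Λ₂}
    (h : coprodCocycle l x = 1) : l = 1 := by
  obtain ⟨w, hw, rfl⟩ := exists_isReduced_wordProd_eq l
  obtain ⟨w', hne, hmap, heq⟩ := exists_coprodCocycle_wordProd_eq hx w hw.1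
  have hw' : w' = [] := by
    by_contra hnil
    exact wordProd_ne_one ⟨hne, hmap ▸ hw.2⟩ hnil (heq ▸ h)
  subst hw'
  rw [List.map_eq_nil_iff.1 hmap.symm, wordProd_nil]

theorem injective_coprod {x : PointedMap Λ₁ Γ₁ × PointedMap Λ₂ Γ₂}
    (hx : Function.Injective x.1 ∧ Function.Injective x.2) : Function.Injective (coprod x) := by
  intro l m h
  -- A cocycle is not a homomorphism: the quotient of the values at `l` and `m` is a cocycle value
  -- at the moved point `coprodAct m x`, whose coordinates are again injective.
  have key : coprodCocycle (l * m⁻¹) (coprodAct m x) = 1 := by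
    have := coprodCocycle_mul (l * m⁻¹) m x
    rw [inv_mul_cancel_right] at this
    exact mul_eq_right.1 (this.symm.trans h)
  exact mul_inv_eq_one.1 (eq_one_of_coprodCocycle_eq_one (injective_coprodAct m hx) key)

/-! ### Invariance of the product measure and measurability -/

variable [Countable Λ₁] [Countable Λ₂] [Countable Γ₁] [Countable Γ₂]

theorem measurePreserving_coprodAct {μ : Measure (PointedMap Λ₁ Γ₁)}
    {ν : Measure (PointedMap Λ₂ Γ₂)} [SFinite μ] [SFinite ν]
    [SMulInvariantMeasure Λ₁ (PointedMap Λ₁ Γ₁) μ]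
    [SMulInvariantMeasure Λ₂ (PointedMap Λ₂ Γ₂) ν] (l : Monoid.Coprod Λ₁ Λ₂) :
    MeasurePreserving (coprodAct l) (μ.prod ν) (μ.prod ν) := by
  induction l using Monoid.Coprod.induction_on' with
  | one =>
    have : coprodAct (1 : Monoid.Coprod Λ₁ Λ₂) =
        (id : PointedMap Λ₁ Γ₁ × PointedMap Λ₂ Γ₂ → _) := funext coprodAct_one
    rw [this]
    exact MeasurePreserving.id _
  | inl_mul a y ih =>
    have ha : MeasurePreserving (fun f => a • f) μ μ :=
      ⟨measurable_smul a, Measure.ext fun s hs => by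
        rw [Measure.map_apply (measurable_smul a) hs]
        exact SMulInvariantMeasure.measure_preimage_smul a hs⟩
    have : coprodAct (inl a * y) = Prod.map (fun f : PointedMap Λ₁ Γ₁ => a • f)
        (id : PointedMap Λ₂ Γ₂ → _) ∘ coprodAct y :=
      funext fun x => coprodAct_mul _ _ _
    rw [this]
    exact (ha.prod (MeasurePreserving.id ν)).comp ih
  | inr_mul a y ih =>
    have ha : MeasurePreserving (fun f => a • f) ν ν :=
      ⟨measurable_smul a, Measure.ext fun s hs => by
        rw [Measure.map_apply (measurable_smul a) hs]
        exact SMulInvariantMeasure.measure_preimage_smul a hs⟩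
    have : coprodAct (inr a * y) = Prod.map (id : PointedMap Λ₁ Γ₁ → _)
        (fun f : PointedMap Λ₂ Γ₂ => a • f) ∘ coprodAct y :=
      funext fun x => coprodAct_mul _ _ _
    rw [this]
    exact ((MeasurePreserving.id μ).prod ha).comp ih

theorem measurable_coprodAct (l : Monoid.Coprod Λ₁ Λ₂) :
    Measurable (coprodAct (Γ₁ := Γ₁) (Γ₂ := Γ₂) l) := by
  induction l using Monoid.Coprod.induction_on' with
  | one =>
    rw [funext coprodAct_one]
    exact measurable_id
  | inl_mul a y ih =>
    rw [funext (coprodAct_mul (inl a) y)]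
    exact ((measurable_smul a).comp (measurable_fst.comp ih)).prodMk (measurable_snd.comp ih)
  | inr_mul a y ih =>
    rw [funext (coprodAct_mul (inr a) y)]
    exact (measurable_fst.comp ih).prodMk ((measurable_smul a).comp (measurable_snd.comp ih))

theorem measurable_coprodCocycle (l : Monoid.Coprod Λ₁ Λ₂) :
    @Measurable (PointedMap Λ₁ Γ₁ × PointedMap Λ₂ Γ₂) (Monoid.Coprod Γ₁ Γ₂) _ ⊤
      (coprodCocycle l) := by
  let _ : MeasurableSpace (Monoid.Coprod Γ₁ Γ₂) := ⊤
  have hmul {F K : PointedMap Λ₁ Γ₁ × PointedMap Λ₂ Γ₂ → Monoid.Coprod Γ₁ Γ₂}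
      (hF : Measurable F) (hK : Measurable K) : Measurable fun x => F x * K x :=
    (measurable_of_countable fun p : Monoid.Coprod Γ₁ Γ₂ × Monoid.Coprod Γ₁ Γ₂ =>
      p.1 * p.2).comp (hF.prodMk hK)
  induction l using Monoid.Coprod.induction_on' with
  | one =>
    have : coprodCocycle (1 : Monoid.Coprod Λ₁ Λ₂) =
        fun _ : PointedMap Λ₁ Γ₁ × PointedMap Λ₂ Γ₂ => (1 : Monoid.Coprod Γ₁ Γ₂) :=
      funext coprodCocycle_one
    rw [this]
    exact measurable_const
  | inl_mul a y ih =>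
    let _ : MeasurableSpace Γ₁ := ⊤
    simp only [funext (coprodCocycle_mul (inl a) y), coprodCocycle_inl]
    exact hmul ((measurable_from_top (f := inl)).comp
      ((measurable_eval a).comp (measurable_fst.comp (measurable_coprodAct y)))) ih
  | inr_mul a y ih =>
    let _ : MeasurableSpace Γ₂ := ⊤
    simp only [funext (coprodCocycle_mul (inr a) y), coprodCocycle_inr]
    exact hmul ((measurable_from_top (f := inr)).comp
      ((measurable_eval a).comp (measurable_snd.comp (measurable_coprodAct y)))) ih

theorem measurable_coprod :
    Measurable (coprod : PointedMap Λ₁ Γ₁ × PointedMap Λ₂ Γ₂ → _) :=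
  measurable_of_eval measurable_coprodCocycle

end Coprod

end PointedMap

open PointedMap in
theorem IsRandembedding.coprod {Λ₁ Λ₂ Γ₁ Γ₂ : Type*} [Group Λ₁] [Group Λ₂] [Group Γ₁] [Group Γ₂]
    [Countable Λ₁] [Countable Λ₂] [Countable Γ₁] [Countable Γ₂]
    {μ : Measure (PointedMap Λ₁ Γ₁)} {ν : Measure (PointedMap Λ₂ Γ₂)}
    (hμ : IsRandembedding μ) (hν : IsRandembedding ν) :
    IsRandembedding ((μ.prod ν).map PointedMap.coprod) := by
  have := hμ.isProbabilityMeasure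
  have := hν.isProbabilityMeasure
  have := hμ.invariant
  have := hν.invariant
  refine ⟨⟨Measure.isProbabilityMeasure_map measurable_coprod.aemeasurable, ⟨?_⟩⟩, ?_⟩
  · intro l s hs
    have hact := measurePreserving_coprodAct (μ := μ) (ν := ν) l
    -- Equivariance reduces invariance of the pushforward to that of `μ.prod ν`.
    have hpre : PointedMap.coprod ⁻¹' ((fun f => l • f) ⁻¹' s) =
        coprodAct l ⁻¹' (PointedMap.coprod ⁻¹' s) := by
      ext x
      simp only [Set.mem_preimage, smul_coprod]
    rw [Measure.map_apply measurable_coprod (PointedMap.measurable_smul l hs),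
      Measure.map_apply measurable_coprod hs, hpre,
      hact.measure_preimage (measurable_coprod hs).nullMeasurableSet]
  · rw [ae_map_iff measurable_coprod.aemeasurable measurableSet_injective]
    filter_upwards [Measure.quasiMeasurePreserving_fst.ae hμ.ae_injective,
      Measure.quasiMeasurePreserving_snd.ae hν.ae_injective] with x h₁ h₂
    exact injective_coprod ⟨h₁, h₂⟩

theorem mainTheorem8 {Λ₁ Λ₂ Γ₁ Γ₂ : Type*} [Group Λ₁] [Group Λ₂] [Group Γ₁] [Group Γ₂]
    [Countable Λ₁] [Countable Λ₂] [Countable Γ₁] [Countable Γ₂]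
    (h₁ : IsRandomSubgroup Λ₁ Γ₁) (h₂ : IsRandomSubgroup Λ₂ Γ₂) :
    IsRandomSubgroup (Monoid.Coprod Λ₁ Λ₂) (Monoid.Coprod Γ₁ Γ₂) := by
  obtain ⟨μ, hμ⟩ := h₁
  obtain ⟨ν, hν⟩ := h₂
  exact ⟨_, hμ.coprod hν⟩
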